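/- For integers $n,a,b,c$ let $R(n,ax^2+bxy+cy^2)$ denote the number of pairs $(x,y)\in\mathbb{Z}^2$ with $n=ax^2+bxy+cy^2$. Define four sets of primes: $$\mathscr{S}_1=\{p \text{ prime}: p\equiv 11 \pmod{24},\ p=5x^2+2xy+11y^2 \text{ for some } x,y\in\mathbb{Z}\},$$ $$\mathscr{S}_2=\{p \text{ prime}: p\equiv 5 \pmod{24},\ p=5x^2+2xy+11y^2 \text{ for some } x,y\in\mathbb{Z}\},$$ $$\mathscr{S}_3=\{q \text{ prime}: q\equiv 1 \pmod{24},\ q=7x^2+6xy+9y^2 \text{ for some } x,y\in\mathbb{Z}\},$$ $$\mathscr{S}_4=\{q \text{ prime}: q\equiv 7 \pmod{24},\ q=7x^2+6xy+9y^2 \text{ for some } x,y\in\mathbb{Z}\}.$$ **Theorem.** Let $m\equiv 11\pmod{24}$ be a square-free integer. Then $$R(m,5x^2+2xy+11y^2)\equiv 2\pmod 4$$ if and only if $m$ can be written in one of the following two forms: (i) $m$ is a product of an odd number of primes from $\mathscr{S}_1$, an even number of primes from $\mathscr{S}_2$, an arbitrary number of primes from $\mathscr{S}_3$, and an even number of primes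 from $\mathscr{S}_4$; (ii) $m$ is a product of an even number of primes from $\mathscr{S}_1$, an odd number of primes from $\mathscr{S}_2$, an arbitrary number of primes from $\mathscr{S}_3$, and an odd number of primes from $\mathscr{S}_4$. Here "even" and "arbitrary" include zero. -/

import Mathlib

/-- The set of pairs `(x, y)` of integers with `n = a x² + b x y + c y²`. -/
def reprSet (n a b c : ℤ) : Set (ℤ × ℤ) :=
  {v | n = a * v.1 ^ 2 + b * v.1 * v.2 + c * v.2 ^ 2}

/-- For a positive definite form, the set of representations of `n` is finite, so that counting
it with `Set.ncard` is meaningful. -/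
theorem reprSet_finite (n a b c : ℤ) (ha : 0 < a) (hD : b ^ 2 - 4 * a * c < 0) :
    (reprSet n a b c).Finite := by
  have hc : 0 < c := by
    by_contra h
    nlinarith [sq_nonneg b, mul_nonneg ha.le (by linarith : 0 ≤ -c)]
  refine Set.Finite.subset
    ((Set.finite_Icc (-(4 * c * n)) (4 * c * n)).prod
      (Set.finite_Icc (-(4 * a * n)) (4 * a * n))) ?_
  rintro ⟨x, y⟩ h
  have h' : n = a * x ^ 2 + b * x * y + c * y ^ 2 := h
  have key : ∀ z : ℤ, |z| ≤ z ^ 2 := fun z => by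
    rw [← sq_abs, pow_two]
    rcases (abs_nonneg z).eq_or_lt with h0 | h0
    · rw [← h0]; simp
    · exact le_mul_of_one_le_left h0.le h0
  have hy : y ^ 2 ≤ 4 * a * n := by
    have e : 4 * a * n = (2 * a * x + b * y) ^ 2 + (4 * a * c - b ^ 2) * y ^ 2 := by
      rw [h']; ring
    nlinarith [sq_nonneg (2 * a * x + b * y), sq_nonneg y,
      mul_nonneg (by linarith : 0 ≤ 4 * a * c - b ^ 2 - 1) (sq_nonneg y)]
  have hx : x ^ 2 ≤ 4 * c * n := by
    have e : 4 * c * n = (2 * c * y + b * x) ^ 2 + (4 * a * c - b ^ 2) * x ^ 2 := by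
      rw [h']; ring
    nlinarith [sq_nonneg (2 * c * y + b * x), sq_nonneg x,
      mul_nonneg (by linarith : 0 ≤ 4 * a * c - b ^ 2 - 1) (sq_nonneg x)]
  exact ⟨abs_le.mp ((key x).trans hx), abs_le.mp ((key y).trans hy)⟩

/-- `R(n, a x² + b x y + c y²)`: the number of representations of `n` by the form
`a x² + b x y + c y²` with `x, y ∈ ℤ`. -/
noncomputable def R (n a b c : ℤ) : ℕ := (reprSet n a b c).ncard

/-- Primes `p ≡ 11 (mod 24)` of the form `5 x² + 2 x y + 11 y²`. -/
def S₁ : Set ℕ :=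
  {p | p.Prime ∧ p ≡ 11 [MOD 24] ∧ ∃ x y : ℤ, (p : ℤ) = 5 * x ^ 2 + 2 * x * y + 11 * y ^ 2}

/-- Primes `p ≡ 5 (mod 24)` of the form `5 x² + 2 x y + 11 y²`. -/
def S₂ : Set ℕ :=
  {p | p.Prime ∧ p ≡ 5 [MOD 24] ∧ ∃ x y : ℤ, (p : ℤ) = 5 * x ^ 2 + 2 * x * y + 11 * y ^ 2}

/-- Primes `q ≡ 1 (mod 24)` of the form `7 x² + 6 x y + 9 y²`. -/
def S₃ : Set ℕ :=
  {q | q.Prime ∧ q ≡ 1 [MOD 24] ∧ ∃ x y : ℤ, (q : ℤ) = 7 * x ^ 2 + 6 * x * y + 9 * y ^ 2}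

/-- Primes `q ≡ 7 (mod 24)` of the form `7 x² + 6 x y + 9 y²`. -/
def S₄ : Set ℕ :=
  {q | q.Prime ∧ q ≡ 7 [MOD 24] ∧ ∃ x y : ℤ, (q : ℤ) = 7 * x ^ 2 + 6 * x * y + 9 * y ^ 2}

/-- `m` is a product of `n₁` elements of `S₁`, `n₂` elements of `S₂`, `n₃` elements of `S₃` and
`n₄` elements of `S₄` (counted with multiplicity; an empty product is `1`). -/
def IsProductOfSizes (m : ℤ) (n₁ n₂ n₃ n₄ : ℕ) : Prop :=
  ∃ (p : Fin n₁ → ℕ) (p' : Fin n₂ → ℕ) (q : Fin n₃ → ℕ) (q' : Fin n₄ → ℕ),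
    (∀ i, p i ∈ S₁) ∧ (∀ i, p' i ∈ S₂) ∧ (∀ i, q i ∈ S₃) ∧ (∀ i, q' i ∈ S₄) ∧
      m = (((∏ i, p i) * (∏ i, p' i) * (∏ i, q i) * (∏ i, q' i) : ℕ) : ℤ)

/-- Form (i): an odd number of factors from `S₁`, an even number from `S₂`, any number from `S₃`,
an even number from `S₄`. -/
def IsFormI (m : ℤ) : Prop :=
  ∃ n₁ n₂ n₃ n₄ : ℕ, Odd n₁ ∧ Even n₂ ∧ Even n₄ ∧ IsProductOfSizes m n₁ n₂ n₃ n₄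

/-- Form (ii): an even number of factors from `S₁`, an odd number from `S₂`, any number from `S₃`,
an odd number from `S₄`. -/
def IsFormII (m : ℤ) : Prop :=
  ∃ n₁ n₂ n₃ n₄ : ℕ, Even n₁ ∧ Odd n₂ ∧ Odd n₄ ∧ IsProductOfSizes m n₁ n₂ n₃ n₄

/-!
The form `5x² + 2xy + 11y²` has discriminant `-216`. The class group for this discriminant is cyclic
of order six; up to orientation its classes are `x² + 54y²` (order 1), `2x² + 27y²` (order 2),
`7x² + 6xy + 9y²` (order 3) and `5x² + 2xy + 11y²` (order 6), and the last one generates.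

The proof rests on the Hecke relation `Similitude.R_mul_eq_add`: if a prime `p ∤ 6n` is represented
by a form in the class `g`, then `R(pn, f) = R(n, fg) + R(n, fg⁻¹)`, because modulo `p` the form `f`
vanishes on exactly two lines, and restricting `f` to the sublattices over these lines gives `p`
times forms in the classes `fg` and `fg⁻¹`. The relations that are needed are made explicit
through composition formulas.

A representation number of a nonzero integer is even (`two_dvd_R`), and a representation number of
one of the two ambiguous forms `x² + 54y²`, `2x² + 27y²` is divisible by four, apart from trivial
exceptions (`four_dvd_R`). So modulo `4` the Hecke relations become very simple. If a prime factor
`p` of `m` is represented by an ambiguous form, the two summands are equal and even, and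
`4 ∣ R(m, 5x² + 2xy + 11y²)`. If all prime factors of `m` are represented by `5x² + 2xy + 11y²` or
`7x² + 6xy + 9y²`, then in each relation one summand is ambiguous, hence negligible, and induction
gives `R(m, 5x² + 2xy + 11y²) ≡ 2` (`R_modEq_two_of_prime_factors`). Reduction theory
(`exists_form_of_prime_dvd`) shows that there are no other cases as soon as `m` is represented.
Hence the congruence says exactly that every prime factor of `m` lies in one of the four sets, and
the parities of the numbers of factors are forced by `m ≡ 11 (mod 24)`
(`IsProductOfSizes.parity`).
-/

/-! ### Similitudes between binary quadratic forms -/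

/-- An integral similitude of multiplier `p` from the form `(a', b', c')` to the form `(a, b, c)`:
a matrix of determinant `± p` (the sign is `e`) along which `(a, b, c)` pulls back to
`p · (a', b', c')`. Its image is an index-`p` sublattice of `ℤ²` on which `(a, b, c)` is divisible
by `p`. -/
structure Similitude (p a b c a' b' c' : ℤ) where
  (m₁₁ m₁₂ m₂₁ m₂₂ e : ℤ)
  e_mul_self : e * e = 1
  det_eq : m₁₁ * m₂₂ - m₁₂ * m₂₁ = e * p
  map_eq : ∀ x y : ℤ,
    a * (m₁₁ * x + m₁₂ * y) ^ 2 + b * (m₁₁ * x + m₁₂ * y) * (m₂₁ * x + m₂₂ * y) +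
      c * (m₂₁ * x + m₂₂ * y) ^ 2 = p * (a' * x ^ 2 + b' * x * y + c' * y ^ 2)

namespace Similitude

variable {p a b c a' b' c' a'' b'' c'' : ℤ}

/-- The action of a similitude on `ℤ²`. -/
def toFun (S : Similitude p a b c a' b' c') (v : ℤ × ℤ) : ℤ × ℤ :=
  (S.m₁₁ * v.1 + S.m₁₂ * v.2, S.m₂₁ * v.1 + S.m₂₂ * v.2)

/-- First coordinate of the adjoint similitude, which is `p` times the inverse. -/
def adj₁ (S : Similitude p a b c a' b' c') (x y : ℤ) : ℤ := S.e * (S.m₂₂ * x - S.m₁₂ * y)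

/-- Second coordinate of the adjoint similitude. -/
def adj₂ (S : Similitude p a b c a' b' c') (x y : ℤ) : ℤ := S.e * (S.m₁₁ * y - S.m₂₁ * x)

theorem adj₁_toFun (S : Similitude p a b c a' b' c') (v : ℤ × ℤ) :
    S.adj₁ (S.toFun v).1 (S.toFun v).2 = p * v.1 := by
  simp only [adj₁, toFun]
  linear_combination S.e * v.1 * S.det_eq + p * v.1 * S.e_mul_self

theorem adj₂_toFun (S : Similitude p a b c a' b' c') (v : ℤ × ℤ) :
    S.adj₂ (S.toFun v).1 (S.toFun v).2 = p * v.2 := by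
  simp only [adj₂, toFun]
  linear_combination S.e * v.2 * S.det_eq + p * v.2 * S.e_mul_self

theorem toFun_injective (hp : p ≠ 0) (S : Similitude p a b c a' b' c') :
    Function.Injective S.toFun := fun v w h => by
  have h1 := S.adj₁_toFun v
  have h2 := S.adj₂_toFun v
  rw [h, S.adj₁_toFun] at h1
  rw [h, S.adj₂_toFun] at h2
  exact Prod.ext (mul_left_cancel₀ hp h1.symm) (mul_left_cancel₀ hp h2.symm)

theorem toFun_mem_iff (hp : p ≠ 0) (S : Similitude p a b c a' b' c') (n : ℤ) (v : ℤ × ℤ) :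
    S.toFun v ∈ reprSet (p * n) a b c ↔ v ∈ reprSet n a' b' c' := by
  simp only [reprSet, Set.mem_ofPred_eq, toFun, S.map_eq]
  exact mul_right_inj' hp

/-- A vector lies in the image of a similitude as soon as its adjoint image is divisible
by `p`. -/
theorem mem_range_of_dvd (hp : p ≠ 0) (S : Similitude p a b c a' b' c') {x y : ℤ}
    (h₁ : p ∣ S.adj₁ x y) (h₂ : p ∣ S.adj₂ x y) : ∃ v, S.toFun v = (x, y) := by
  obtain ⟨s, hs⟩ := h₁
  obtain ⟨t, ht⟩ := h₂
  simp only [adj₁, adj₂] at hs ht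
  refine ⟨(s, t), Prod.ext (mul_left_cancel₀ hp ?_) (mul_left_cancel₀ hp ?_)⟩
  · simp only [toFun]
    linear_combination -S.m₁₁ * hs - S.m₁₂ * ht + S.e * x * S.det_eq + p * x * S.e_mul_self
  · simp only [toFun]
    linear_combination -S.m₂₁ * hs - S.m₂₂ * ht + S.e * y * S.det_eq + p * y * S.e_mul_self

/-- The Hecke relation at a prime `p` for representation numbers. Modulo `p` the form `(a, b, c)`
vanishes on two lines; `S` and `T` parametrize the sublattices over these lines. The hypothesis
`hprod` says that a vector on which the form is divisible by `p` lies on one of the lines, and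
`hinf` that the lines are distinct. -/
theorem R_mul_eq_add (hp : Prime p) (ha : 0 < a) (hD : b ^ 2 - 4 * a * c < 0)
    (S : Similitude p a b c a' b' c') (T : Similitude p a b c a'' b'' c'') {n : ℤ} (hn : ¬ p ∣ n)
    (hprod : ∀ x y, p * n = a * x ^ 2 + b * x * y + c * y ^ 2 →
      (p ∣ S.adj₁ x y * T.adj₁ x y ∧ p ∣ S.adj₁ x y * T.adj₂ x y) ∧
        p ∣ S.adj₂ x y * T.adj₁ x y ∧ p ∣ S.adj₂ x y * T.adj₂ x y)
    (hinf : ∀ x y, p ∣ S.adj₁ x y → p ∣ S.adj₂ x y → p ∣ T.adj₁ x y → p ∣ T.adj₂ x y →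
      p ∣ x ∧ p ∣ y) :
    R (p * n) a b c = R n a' b' c' + R n a'' b'' c'' := by
  have hp0 := hp.ne_zero
  have hfin := reprSet_finite (p * n) a b c ha hD
  have hunion : reprSet (p * n) a b c =
      S.toFun '' reprSet n a' b' c' ∪ T.toFun '' reprSet n a'' b'' c'' := by
    apply Set.Subset.antisymm
    · rintro ⟨x, y⟩ hv
      obtain ⟨⟨h11, h12⟩, h21, h22⟩ := hprod x y hv
      have key : (p ∣ S.adj₁ x y ∧ p ∣ S.adj₂ x y) ∨ (p ∣ T.adj₁ x y ∧ p ∣ T.adj₂ x y) := by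
        rcases hp.dvd_or_dvd h11 with h | h <;> rcases hp.dvd_or_dvd h12 with h' | h' <;>
          rcases hp.dvd_or_dvd h21 with k | k <;> rcases hp.dvd_or_dvd h22 with k' | k' <;> tauto
      rcases key with ⟨h₁, h₂⟩ | ⟨h₁, h₂⟩
      · obtain ⟨w, hw⟩ := S.mem_range_of_dvd hp0 h₁ h₂
        exact Or.inl ⟨w, (S.toFun_mem_iff hp0 n w).1 (hw ▸ hv), hw⟩
      · obtain ⟨w, hw⟩ := T.mem_range_of_dvd hp0 h₁ h₂
        exact Or.inr ⟨w, (T.toFun_mem_iff hp0 n w).1 (hw ▸ hv), hw⟩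
    · rintro v (⟨w, hw, rfl⟩ | ⟨w, hw, rfl⟩)
      · exact (S.toFun_mem_iff hp0 n w).2 hw
      · exact (T.toFun_mem_iff hp0 n w).2 hw
  have hdisj : Disjoint (S.toFun '' reprSet n a' b' c') (T.toFun '' reprSet n a'' b'' c'') := by
    rw [Set.disjoint_left]
    rintro v ⟨w, hw, rfl⟩ ⟨w', -, h⟩
    obtain ⟨⟨s, hs⟩, ⟨t, ht⟩⟩ := hinf (S.toFun w).1 (S.toFun w).2
      (S.adj₁_toFun w ▸ dvd_mul_right _ _) (S.adj₂_toFun w ▸ dvd_mul_right _ _)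
      (h ▸ T.adj₁_toFun w' ▸ dvd_mul_right _ _) (h ▸ T.adj₂_toFun w' ▸ dvd_mul_right _ _)
    have hv : p * n = _ := (S.toFun_mem_iff hp0 n w).2 hw
    rw [hs, ht] at hv
    refine hn ⟨a * s ^ 2 + b * s * t + c * t ^ 2, mul_left_cancel₀ hp0 ?_⟩
    linear_combination hv
  have hfin' := hunion ▸ hfin
  rw [R, hunion, Set.ncard_union_eq hdisj (hfin'.subset Set.subset_union_left)
    (hfin'.subset Set.subset_union_right), Set.ncard_image_of_injective _ (S.toFun_injective hp0),
    Set.ncard_image_of_injective _ (T.toFun_injective hp0), R, R]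

end Similitude

/-! ### Hecke relations between the forms of discriminant `-216`

The two similitudes in each relation are Gauss compositions with a form representing `p = g(u, v)`.
With `f` the form in question, each product of an `S`-adjoint and a `T`-adjoint coordinate lies in
the ideal generated by `g(u, v)` and `f(x, y)`; and the span of the four adjoint coordinates
contains `108 u x`, `108 v x`, `108 u y` and `108 v y`, which separates the two lines as `p ∤ 6`.
-/

theorem not_dvd_and_dvd_of_prime_eq {p a b c u v : ℤ} (hp : Prime p)
    (hg : p = a * u ^ 2 + b * u * v + c * v ^ 2) : ¬ (p ∣ u ∧ p ∣ v) := by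
  rintro ⟨⟨s, hs⟩, ⟨t, ht⟩⟩
  refine hp.not_isUnit (IsUnit.of_mul_eq_one (a * s ^ 2 + b * s * t + c * t ^ 2)
    (mul_left_cancel₀ hp.ne_zero ?_))
  rw [hs, ht] at hg
  linear_combination -hg

theorem dvd_of_dvd_mul_of_not_dvd_and {p u v x : ℤ} (hp : Prime p) (h6 : ¬ p ∣ 6)
    (huv : ¬ (p ∣ u ∧ p ∣ v)) (hu : p ∣ 108 * (u * x)) (hv : p ∣ 108 * (v * x)) : p ∣ x := by
  have h108 : ¬ p ∣ 108 := fun h =>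
    h6 (hp.dvd_of_dvd_pow (n := 3) (h.trans (by norm_num)))
  rcases (hp.dvd_or_dvd hu).resolve_left h108 |> hp.dvd_or_dvd with h | h
  · rcases (hp.dvd_or_dvd hv).resolve_left h108 |> hp.dvd_or_dvd with h' | h'
    · exact absurd ⟨h, h'⟩ huv
    · exact h'
  · exact h

/-- Hecke relation for `5x² + 2xy + 11y²` at a prime represented by `x² + 54y²`. -/
theorem R_mul_5_of_eq_1 {p n u v : ℤ} (hp : Prime p) (h6 : ¬ p ∣ 6) (hn : ¬ p ∣ n)
    (hg : p = u ^ 2 + 54 * v ^ 2) :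
    R (p * n) 5 2 11 = R n 5 2 11 + R n 5 2 11 := by
  let S : Similitude p 5 2 11 5 2 11 :=
    ⟨u - v, -11 * v, 5 * v, u + v, 1, by norm_num,
      by rw [hg]; ring, fun x y => by rw [hg]; ring⟩
  let T : Similitude p 5 2 11 5 2 11 :=
    ⟨u + v, 11 * v, -5 * v, u - v, 1, by norm_num,
      by rw [hg]; ring, fun x y => by rw [hg]; ring⟩
  have hS₁ (x y : ℤ) : S.adj₁ x y = u * x + v * x + 11 * v * y := by
    simp only [Similitude.adj₁, S]; ring
  have hS₂ (x y : ℤ) : S.adj₂ x y = u * y - v * y - 5 * v * x := by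
    simp only [Similitude.adj₂, S]; ring
  have hT₁ (x y : ℤ) : T.adj₁ x y = u * x - v * x - 11 * v * y := by
    simp only [Similitude.adj₁, T]; ring
  have hT₂ (x y : ℤ) : T.adj₂ x y = u * y + v * y + 5 * v * x := by
    simp only [Similitude.adj₂, T]; ring
  refine S.R_mul_eq_add hp (by norm_num) (by norm_num) T hn (fun x y h => ?_)
    (fun x y h₁ h₂ h₃ h₄ => ?_)
  · rw [hS₁, hS₂, hT₁, hT₂]
    refine ⟨⟨⟨x ^ 2 + n * (-11 * v ^ 2), ?_⟩,
      ⟨x * y + n * (u * v + v ^ 2), ?_⟩⟩,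
      ⟨x * y + n * (-u * v + v ^ 2), ?_⟩,
      ⟨y ^ 2 + n * (-5 * v ^ 2), ?_⟩⟩
    · linear_combination -(x ^ 2) * hg -
        (-11 * v ^ 2) * h
    · linear_combination -(x * y) * hg -
        (u * v + v ^ 2) * h
    · linear_combination -(x * y) * hg -
        (-u * v + v ^ 2) * h
    · linear_combination -(y ^ 2) * hg -
        (-5 * v ^ 2) * h
  · rw [hS₁] at h₁
    rw [hS₂] at h₂
    rw [hT₁] at h₃
    rw [hT₂] at h₄
    obtain ⟨r₁, h₁⟩ := h₁
    obtain ⟨r₂, h₂⟩ := h₂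
    obtain ⟨r₃, h₃⟩ := h₃
    obtain ⟨r₄, h₄⟩ := h₄
    have huv : ¬ (p ∣ u ∧ p ∣ v) := not_dvd_and_dvd_of_prime_eq hp
      (a := 1) (b := 0) (c := 54) (by linear_combination hg)
    exact ⟨dvd_of_dvd_mul_of_not_dvd_and hp h6 huv
        ⟨54 * r₁ + 54 * r₃,
          by linear_combination 54 * h₁ + 54 * h₃⟩
        ⟨-r₁ - 11 * r₂ + r₃ + 11 * r₄,
          by linear_combination -h₁ - 11 * h₂ + h₃ + 11 * h₄⟩,
      dvd_of_dvd_mul_of_not_dvd_and hp h6 huv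
        ⟨54 * r₂ + 54 * r₄,
          by linear_combination 54 * h₂ + 54 * h₄⟩
        ⟨5 * r₁ + r₂ - 5 * r₃ - r₄,
          by linear_combination 5 * h₁ + h₂ - 5 * h₃ - h₄⟩⟩

/-- Hecke relation for `5x² + 2xy + 11y²` at a prime represented by `2x² + 27y²`. -/
theorem R_mul_5_of_eq_2 {p n u v : ℤ} (hp : Prime p) (h6 : ¬ p ∣ 6) (hn : ¬ p ∣ n)
    (hg : p = 2 * u ^ 2 + 27 * v ^ 2) :
    R (p * n) 5 2 11 = R n 7 6 9 + R n 7 6 9 := by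
  let S : Similitude p 5 2 11 7 6 9 :=
    ⟨u - 5 * v, -u - 6 * v, -u - 2 * v, -u + 3 * v, -1, by norm_num,
      by rw [hg]; ring, fun x y => by rw [hg]; ring⟩
  let T : Similitude p 5 2 11 7 6 9 :=
    ⟨u + 5 * v, -u + 6 * v, -u + 2 * v, -u - 3 * v, -1, by norm_num,
      by rw [hg]; ring, fun x y => by rw [hg]; ring⟩
  have hS₁ (x y : ℤ) : S.adj₁ x y = u * x - 3 * v * x - u * y - 6 * v * y := by
    simp only [Similitude.adj₁, S]; ring
  have hS₂ (x y : ℤ) : S.adj₂ x y = -u * y + 5 * v * y - u * x - 2 * v * x := by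
    simp only [Similitude.adj₂, S]; ring
  have hT₁ (x y : ℤ) : T.adj₁ x y = u * x + 3 * v * x - u * y + 6 * v * y := by
    simp only [Similitude.adj₁, T]; ring
  have hT₂ (x y : ℤ) : T.adj₂ x y = -u * y - 5 * v * y - u * x + 2 * v * x := by
    simp only [Similitude.adj₂, T]; ring
  refine S.R_mul_eq_add hp (by norm_num) (by norm_num) T hn (fun x y h => ?_)
    (fun x y h₁ h₂ h₃ h₄ => ?_)
  · rw [hS₁, hS₂, hT₁, hT₂]
    refine ⟨⟨⟨-2 * x ^ 2 - 2 * x * y - 5 * y ^ 2 + n * (u ^ 2 + 9 * v ^ 2), ?_⟩,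
      ⟨2 * x ^ 2 + x * y + 6 * y ^ 2 + n * (-u ^ 2 + u * v - 12 * v ^ 2), ?_⟩⟩,
      ⟨2 * x ^ 2 + x * y + 6 * y ^ 2 + n * (-u ^ 2 - u * v - 12 * v ^ 2), ?_⟩,
      ⟨-2 * x ^ 2 - 5 * y ^ 2 + n * (u ^ 2 + 10 * v ^ 2), ?_⟩⟩
    · linear_combination -(-2 * x ^ 2 - 2 * x * y - 5 * y ^ 2) * hg -
        (u ^ 2 + 9 * v ^ 2) * h
    · linear_combination -(2 * x ^ 2 + x * y + 6 * y ^ 2) * hg -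
        (-u ^ 2 + u * v - 12 * v ^ 2) * h
    · linear_combination -(2 * x ^ 2 + x * y + 6 * y ^ 2) * hg -
        (-u ^ 2 - u * v - 12 * v ^ 2) * h
    · linear_combination -(-2 * x ^ 2 - 5 * y ^ 2) * hg -
        (u ^ 2 + 10 * v ^ 2) * h
  · rw [hS₁] at h₁
    rw [hS₂] at h₂
    rw [hT₁] at h₃
    rw [hT₂] at h₄
    obtain ⟨r₁, h₁⟩ := h₁
    obtain ⟨r₂, h₂⟩ := h₂
    obtain ⟨r₃, h₃⟩ := h₃
    obtain ⟨r₄, h₄⟩ := h₄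
    have huv : ¬ (p ∣ u ∧ p ∣ v) := not_dvd_and_dvd_of_prime_eq hp
      (a := 2) (b := 0) (c := 27) (by linear_combination hg)
    exact ⟨dvd_of_dvd_mul_of_not_dvd_and hp h6 huv
        ⟨27 * r₁ - 27 * r₂ + 27 * r₃ - 27 * r₄,
          by linear_combination 27 * h₁ - 27 * h₂ + 27 * h₃ - 27 * h₄⟩
        ⟨-10 * r₁ - 12 * r₂ + 10 * r₃ + 12 * r₄,
          by linear_combination -10 * h₁ - 12 * h₂ + 10 * h₃ + 12 * h₄⟩,
      dvd_of_dvd_mul_of_not_dvd_and hp h6 huv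
        ⟨-27 * r₁ - 27 * r₂ - 27 * r₃ - 27 * r₄,
          by linear_combination -27 * h₁ - 27 * h₂ - 27 * h₃ - 27 * h₄⟩
        ⟨-4 * r₁ + 6 * r₂ + 4 * r₃ - 6 * r₄,
          by linear_combination -4 * h₁ + 6 * h₂ + 4 * h₃ - 6 * h₄⟩⟩

/-- Hecke relation for `5x² + 2xy + 11y²` at a prime represented by `7x² + 6xy + 9y²`. -/
theorem R_mul_5_of_eq_7 {p n u v : ℤ} (hp : Prime p) (h6 : ¬ p ∣ 6) (hn : ¬ p ∣ n)
    (hg : p = 7 * u ^ 2 + 6 * u * v + 9 * v ^ 2) :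
    R (p * n) 5 2 11 = R n 2 0 27 + R n 5 2 11 := by
  let S : Similitude p 5 2 11 2 0 27 :=
    ⟨u - v, -5 * u - 6 * v, -u - v, -2 * u + 3 * v, -1, by norm_num,
      by rw [hg]; ring, fun x y => by rw [hg]; ring⟩
  let T : Similitude p 5 2 11 5 2 11 :=
    ⟨2 * u - v, 3 * u + 4 * v, u + 2 * v, -2 * u + v, -1, by norm_num,
      by rw [hg]; ring, fun x y => by rw [hg]; ring⟩
  have hS₁ (x y : ℤ) : S.adj₁ x y = 2 * u * x - 3 * v * x - 5 * u * y - 6 * v * y := by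
    simp only [Similitude.adj₁, S]; ring
  have hS₂ (x y : ℤ) : S.adj₂ x y = -u * y + v * y - u * x - v * x := by
    simp only [Similitude.adj₂, S]; ring
  have hT₁ (x y : ℤ) : T.adj₁ x y = 2 * u * x - v * x + 3 * u * y + 4 * v * y := by
    simp only [Similitude.adj₁, T]; ring
  have hT₂ (x y : ℤ) : T.adj₂ x y = -2 * u * y + v * y + u * x + 2 * v * x := by
    simp only [Similitude.adj₂, T]; ring
  refine S.R_mul_eq_add hp (by norm_num) (by norm_num) T hn (fun x y h => ?_)
    (fun x y h₁ h₂ h₃ h₄ => ?_)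
  · rw [hS₁, hS₂, hT₁, hT₂]
    refine ⟨⟨⟨2 * x ^ 2 + y ^ 2 + n * (-2 * u ^ 2 - 4 * u * v - 3 * v ^ 2), ?_⟩,
      ⟨x ^ 2 - x * y + 3 * y ^ 2 + n * (-u ^ 2 - u * v - 3 * v ^ 2), ?_⟩⟩,
      ⟨-x ^ 2 - x * y - 2 * y ^ 2 + n * (u ^ 2 + u * v + 2 * v ^ 2), ?_⟩,
      ⟨2 * x ^ 2 + x * y + 5 * y ^ 2 + n * (-3 * u ^ 2 - 3 * u * v - 4 * v ^ 2), ?_⟩⟩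
    · linear_combination -(2 * x ^ 2 + y ^ 2) * hg -
        (-2 * u ^ 2 - 4 * u * v - 3 * v ^ 2) * h
    · linear_combination -(x ^ 2 - x * y + 3 * y ^ 2) * hg -
        (-u ^ 2 - u * v - 3 * v ^ 2) * h
    · linear_combination -(-x ^ 2 - x * y - 2 * y ^ 2) * hg -
        (u ^ 2 + u * v + 2 * v ^ 2) * h
    · linear_combination -(2 * x ^ 2 + x * y + 5 * y ^ 2) * hg -
        (-3 * u ^ 2 - 3 * u * v - 4 * v ^ 2) * h
  · rw [hS₁] at h₁
    rw [hS₂] at h₂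
    rw [hT₁] at h₃
    rw [hT₂] at h₄
    obtain ⟨r₁, h₁⟩ := h₁
    obtain ⟨r₂, h₂⟩ := h₂
    obtain ⟨r₃, h₃⟩ := h₃
    obtain ⟨r₄, h₄⟩ := h₄
    have huv : ¬ (p ∣ u ∧ p ∣ v) := not_dvd_and_dvd_of_prime_eq hp
      (a := 7) (b := 6) (c := 9) (by linear_combination hg)
    exact ⟨dvd_of_dvd_mul_of_not_dvd_and hp h6 huv
        ⟨12 * r₁ - 27 * r₂ + 21 * r₃ + 15 * r₄,
          by linear_combination 12 * h₁ - 27 * h₂ + 21 * h₃ + 15 * h₄⟩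
        ⟨-10 * r₁ - 27 * r₂ - 13 * r₃ + 19 * r₄,
          by linear_combination -10 * h₁ - 27 * h₂ - 13 * h₃ + 19 * h₄⟩,
      dvd_of_dvd_mul_of_not_dvd_and hp h6 huv
        ⟨-6 * r₁ - 27 * r₂ + 3 * r₃ - 21 * r₄,
          by linear_combination -6 * h₁ - 27 * h₂ + 3 * h₃ - 21 * h₄⟩
        ⟨-4 * r₁ + 27 * r₂ + 11 * r₃ + 13 * r₄,
          by linear_combination -4 * h₁ + 27 * h₂ + 11 * h₃ + 13 * h₄⟩⟩

/-- Hecke relation for `5x² + 2xy + 11y²` at a prime represented by `5x² + 2xy + 11y²`. -/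
theorem R_mul_5_of_eq_5 {p n u v : ℤ} (hp : Prime p) (h6 : ¬ p ∣ 6) (hn : ¬ p ∣ n)
    (hg : p = 5 * u ^ 2 + 2 * u * v + 11 * v ^ 2) :
    R (p * n) 5 2 11 = R n 1 0 54 + R n 7 6 9 := by
  let S : Similitude p 5 2 11 1 0 54 :=
    ⟨u, -u - 11 * v, v, 5 * u + v, 1, by norm_num,
      by rw [hg]; ring, fun x y => by rw [hg]; ring⟩
  let T : Similitude p 5 2 11 7 6 9 :=
    ⟨2 * u + 3 * v, -u + 4 * v, u - 2 * v, 2 * u + v, 1, by norm_num,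
      by rw [hg]; ring, fun x y => by rw [hg]; ring⟩
  have hS₁ (x y : ℤ) : S.adj₁ x y = 5 * u * x + v * x + u * y + 11 * v * y := by
    simp only [Similitude.adj₁, S]; ring
  have hS₂ (x y : ℤ) : S.adj₂ x y = u * y - v * x := by
    simp only [Similitude.adj₂, S]; ring
  have hT₁ (x y : ℤ) : T.adj₁ x y = 2 * u * x + v * x + u * y - 4 * v * y := by
    simp only [Similitude.adj₁, T]; ring
  have hT₂ (x y : ℤ) : T.adj₂ x y = 2 * u * y + 3 * v * y - u * x + 2 * v * x := by
    simp only [Similitude.adj₂, T]; ring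
  refine S.R_mul_eq_add hp (by norm_num) (by norm_num) T hn (fun x y h => ?_)
    (fun x y h₁ h₂ h₃ h₄ => ?_)
  · rw [hS₁, hS₂, hT₁, hT₂]
    refine ⟨⟨⟨x ^ 2 + x * y - 2 * y ^ 2 + n * (u ^ 2 + u * v - 2 * v ^ 2), ?_⟩,
      ⟨-3 * x ^ 2 + x * y - 4 * y ^ 2 + n * (2 * u ^ 2 + 3 * u * v + 7 * v ^ 2), ?_⟩⟩,
      ⟨-x ^ 2 - 2 * y ^ 2 + n * (u ^ 2 + 2 * v ^ 2), ?_⟩,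
      ⟨-2 * x ^ 2 - x * y - 4 * y ^ 2 + n * (2 * u ^ 2 + u * v + 4 * v ^ 2), ?_⟩⟩
    · linear_combination -(x ^ 2 + x * y - 2 * y ^ 2) * hg -
        (u ^ 2 + u * v - 2 * v ^ 2) * h
    · linear_combination -(-3 * x ^ 2 + x * y - 4 * y ^ 2) * hg -
        (2 * u ^ 2 + 3 * u * v + 7 * v ^ 2) * h
    · linear_combination -(-x ^ 2 - 2 * y ^ 2) * hg -
        (u ^ 2 + 2 * v ^ 2) * h
    · linear_combination -(-2 * x ^ 2 - x * y - 4 * y ^ 2) * hg -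
        (2 * u ^ 2 + u * v + 4 * v ^ 2) * h
  · rw [hS₁] at h₁
    rw [hS₂] at h₂
    rw [hT₁] at h₃
    rw [hT₂] at h₄
    obtain ⟨r₁, h₁⟩ := h₁
    obtain ⟨r₂, h₂⟩ := h₂
    obtain ⟨r₃, h₃⟩ := h₃
    obtain ⟨r₄, h₄⟩ := h₄
    have huv : ¬ (p ∣ u ∧ p ∣ v) := not_dvd_and_dvd_of_prime_eq hp
      (a := 5) (b := 2) (c := 11) (by linear_combination hg)
    exact ⟨dvd_of_dvd_mul_of_not_dvd_and hp h6 huv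
        ⟨11 * r₁ + 19 * r₃ - 15 * r₄,
          by linear_combination 11 * h₁ + 19 * h₃ - 15 * h₄⟩
        ⟨-r₁ - 54 * r₂ + 13 * r₃ + 21 * r₄,
          by linear_combination -h₁ - 54 * h₂ + 13 * h₃ + 21 * h₄⟩,
      dvd_of_dvd_mul_of_not_dvd_and hp h6 huv
        ⟨-r₁ + 54 * r₂ + 13 * r₃ + 21 * r₄,
          by linear_combination -h₁ + 54 * h₂ + 13 * h₃ + 21 * h₄⟩
        ⟨5 * r₁ - 11 * r₃ + 3 * r₄,
          by linear_combination 5 * h₁ - 11 * h₃ + 3 * h₄⟩⟩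

/-- Hecke relation for `7x² + 6xy + 9y²` at a prime represented by `7x² + 6xy + 9y²`. -/
theorem R_mul_7_of_eq_7 {p n u v : ℤ} (hp : Prime p) (h6 : ¬ p ∣ 6) (hn : ¬ p ∣ n)
    (hg : p = 7 * u ^ 2 + 6 * u * v + 9 * v ^ 2) :
    R (p * n) 7 6 9 = R n 1 0 54 + R n 7 6 9 := by
  let S : Similitude p 7 6 9 1 0 54 :=
    ⟨u, -3 * u - 9 * v, v, 7 * u + 3 * v, 1, by norm_num,
      by rw [hg]; ring, fun x y => by rw [hg]; ring⟩
  let T : Similitude p 7 6 9 7 6 9 :=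
    ⟨2 * u + 3 * v, 3 * u, u - 2 * v, -2 * u - 3 * v, -1, by norm_num,
      by rw [hg]; ring, fun x y => by rw [hg]; ring⟩
  have hS₁ (x y : ℤ) : S.adj₁ x y = 7 * u * x + 3 * v * x + 3 * u * y + 9 * v * y := by
    simp only [Similitude.adj₁, S]; ring
  have hS₂ (x y : ℤ) : S.adj₂ x y = u * y - v * x := by
    simp only [Similitude.adj₂, S]; ring
  have hT₁ (x y : ℤ) : T.adj₁ x y = 2 * u * x + 3 * v * x + 3 * u * y := by
    simp only [Similitude.adj₁, T]; ring
  have hT₂ (x y : ℤ) : T.adj₂ x y = -2 * u * y - 3 * v * y + u * x - 2 * v * x := by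
    simp only [Similitude.adj₂, T]; ring
  refine S.R_mul_eq_add hp (by norm_num) (by norm_num) T hn (fun x y h => ?_)
    (fun x y h₁ h₂ h₃ h₄ => ?_)
  · rw [hS₁, hS₂, hT₁, hT₂]
    refine ⟨⟨⟨x ^ 2 + 3 * x * y + n * (u ^ 2 + 3 * u * v), ?_⟩,
      ⟨-3 * x ^ 2 - 5 * x * y - 6 * y ^ 2 + n * (4 * u ^ 2 + u * v + 3 * v ^ 2), ?_⟩⟩,
      ⟨2 * x ^ 2 + 2 * x * y + 3 * y ^ 2 + n * (-2 * u ^ 2 - 2 * u * v - 3 * v ^ 2), ?_⟩,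
      ⟨x ^ 2 + x * y + y ^ 2 + n * (-u ^ 2 - u * v - v ^ 2), ?_⟩⟩
    · linear_combination -(x ^ 2 + 3 * x * y) * hg -
        (u ^ 2 + 3 * u * v) * h
    · linear_combination -(-3 * x ^ 2 - 5 * x * y - 6 * y ^ 2) * hg -
        (4 * u ^ 2 + u * v + 3 * v ^ 2) * h
    · linear_combination -(2 * x ^ 2 + 2 * x * y + 3 * y ^ 2) * hg -
        (-2 * u ^ 2 - 2 * u * v - 3 * v ^ 2) * h
    · linear_combination -(x ^ 2 + x * y + y ^ 2) * hg -
        (-u ^ 2 - u * v - v ^ 2) * h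
  · rw [hS₁] at h₁
    rw [hS₂] at h₂
    rw [hT₁] at h₃
    rw [hT₂] at h₄
    obtain ⟨r₁, h₁⟩ := h₁
    obtain ⟨r₂, h₂⟩ := h₂
    obtain ⟨r₃, h₃⟩ := h₃
    obtain ⟨r₄, h₄⟩ := h₄
    have huv : ¬ (p ∣ u ∧ p ∣ v) := not_dvd_and_dvd_of_prime_eq hp
      (a := 7) (b := 6) (c := 9) (by linear_combination hg)
    exact ⟨dvd_of_dvd_mul_of_not_dvd_and hp h6 huv
        ⟨9 * r₁ + 9 * r₃ + 27 * r₄,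
          by linear_combination 9 * h₁ + 9 * h₃ + 27 * h₄⟩
        ⟨-3 * r₁ - 54 * r₂ + 15 * r₃ - 9 * r₄,
          by linear_combination -3 * h₁ - 54 * h₂ + 15 * h₃ - 9 * h₄⟩,
      dvd_of_dvd_mul_of_not_dvd_and hp h6 huv
        ⟨-3 * r₁ + 54 * r₂ + 15 * r₃ - 9 * r₄,
          by linear_combination -3 * h₁ + 54 * h₂ + 15 * h₃ - 9 * h₄⟩
        ⟨7 * r₁ - 17 * r₃ - 15 * r₄,
          by linear_combination 7 * h₁ - 17 * h₃ - 15 * h₄⟩⟩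

/-- Hecke relation for `7x² + 6xy + 9y²` at a prime represented by `5x² + 2xy + 11y²`. -/
theorem R_mul_7_of_eq_5 {p n u v : ℤ} (hp : Prime p) (h6 : ¬ p ∣ 6) (hn : ¬ p ∣ n)
    (hg : p = 5 * u ^ 2 + 2 * u * v + 11 * v ^ 2) :
    R (p * n) 7 6 9 = R n 2 0 27 + R n 5 2 11 := by
  let S : Similitude p 7 6 9 2 0 27 :=
    ⟨u - v, -3 * u - 6 * v, -u - v, -2 * u + 5 * v, -1, by norm_num,
      by rw [hg]; ring, fun x y => by rw [hg]; ring⟩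
  let T : Similitude p 7 6 9 5 2 11 :=
    ⟨2 * u + v, u - 4 * v, -u + 2 * v, 2 * u + 3 * v, 1, by norm_num,
      by rw [hg]; ring, fun x y => by rw [hg]; ring⟩
  have hS₁ (x y : ℤ) : S.adj₁ x y = 2 * u * x - 5 * v * x - 3 * u * y - 6 * v * y := by
    simp only [Similitude.adj₁, S]; ring
  have hS₂ (x y : ℤ) : S.adj₂ x y = -u * y + v * y - u * x - v * x := by
    simp only [Similitude.adj₂, S]; ring
  have hT₁ (x y : ℤ) : T.adj₁ x y = 2 * u * x + 3 * v * x - u * y + 4 * v * y := by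
    simp only [Similitude.adj₁, T]; ring
  have hT₂ (x y : ℤ) : T.adj₂ x y = 2 * u * y + v * y + u * x - 2 * v * x := by
    simp only [Similitude.adj₂, T]; ring
  refine S.R_mul_eq_add hp (by norm_num) (by norm_num) T hn (fun x y h => ?_)
    (fun x y h₁ h₂ h₃ h₄ => ?_)
  · rw [hS₁, hS₂, hT₁, hT₂]
    refine ⟨⟨⟨-2 * x ^ 2 - 4 * x * y - 3 * y ^ 2 + n * (2 * u ^ 2 + v ^ 2), ?_⟩,
      ⟨-x ^ 2 - x * y - 3 * y ^ 2 + n * (u ^ 2 - u * v + 3 * v ^ 2), ?_⟩⟩,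
      ⟨x ^ 2 + x * y + 2 * y ^ 2 + n * (-u ^ 2 - u * v - 2 * v ^ 2), ?_⟩,
      ⟨-3 * x ^ 2 - 3 * x * y - 4 * y ^ 2 + n * (2 * u ^ 2 + u * v + 5 * v ^ 2), ?_⟩⟩
    · linear_combination -(-2 * x ^ 2 - 4 * x * y - 3 * y ^ 2) * hg -
        (2 * u ^ 2 + v ^ 2) * h
    · linear_combination -(-x ^ 2 - x * y - 3 * y ^ 2) * hg -
        (u ^ 2 - u * v + 3 * v ^ 2) * h
    · linear_combination -(x ^ 2 + x * y + 2 * y ^ 2) * hg -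
        (-u ^ 2 - u * v - 2 * v ^ 2) * h
    · linear_combination -(-3 * x ^ 2 - 3 * x * y - 4 * y ^ 2) * hg -
        (2 * u ^ 2 + u * v + 5 * v ^ 2) * h
  · rw [hS₁] at h₁
    rw [hS₂] at h₂
    rw [hT₁] at h₃
    rw [hT₂] at h₄
    obtain ⟨r₁, h₁⟩ := h₁
    obtain ⟨r₂, h₂⟩ := h₂
    obtain ⟨r₃, h₃⟩ := h₃
    obtain ⟨r₄, h₄⟩ := h₄
    have huv : ¬ (p ∣ u ∧ p ∣ v) := not_dvd_and_dvd_of_prime_eq hp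
      (a := 5) (b := 2) (c := 11) (by linear_combination hg)
    exact ⟨dvd_of_dvd_mul_of_not_dvd_and hp h6 huv
        ⟨12 * r₁ - 27 * r₂ + 21 * r₃ + 15 * r₄,
          by linear_combination 12 * h₁ - 27 * h₂ + 21 * h₃ + 15 * h₄⟩
        ⟨-6 * r₁ - 27 * r₂ + 3 * r₃ - 21 * r₄,
          by linear_combination -6 * h₁ - 27 * h₂ + 3 * h₃ - 21 * h₄⟩,
      dvd_of_dvd_mul_of_not_dvd_and hp h6 huv
        ⟨-10 * r₁ - 27 * r₂ - 13 * r₃ + 19 * r₄,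
          by linear_combination -10 * h₁ - 27 * h₂ - 13 * h₃ + 19 * h₄⟩
        ⟨-4 * r₁ + 27 * r₂ + 11 * r₃ + 13 * r₄,
          by linear_combination -4 * h₁ + 27 * h₂ + 11 * h₃ + 13 * h₄⟩⟩

/-! ### Reduction of forms of discriminant `-216` -/

/-- Every value of the form `(a, b, c)` is a value of the form `(a', b', c')`. -/
def ValuesSubset (a b c a' b' c' : ℤ) : Prop :=
  ∀ x y : ℤ, ∃ x' y' : ℤ,
    a * x ^ 2 + b * x * y + c * y ^ 2 = a' * x' ^ 2 + b' * x' * y' + c' * y' ^ 2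

theorem ValuesSubset.trans {a b c a' b' c' a'' b'' c'' : ℤ} (h : ValuesSubset a b c a' b' c')
    (h' : ValuesSubset a' b' c' a'' b'' c'') : ValuesSubset a b c a'' b'' c'' := fun x y => by
  obtain ⟨u, v, e⟩ := h x y
  obtain ⟨s, t, e'⟩ := h' u v
  exact ⟨s, t, e.trans e'⟩

/-- The values of the form `(a, b, c)` are values of a reduced form of discriminant `-216`. The four
primitive reduced forms are listed up to orientation; of the two imprimitive ones, `3x² + 18y²` and
`6x² + 9y²`, only the divisibility of their values by `3` is recorded. -/
def HasReducedValues (a b c : ℤ) : Prop :=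
  ValuesSubset a b c 1 0 54 ∨ ValuesSubset a b c 2 0 27 ∨ ValuesSubset a b c 5 2 11 ∨
    ValuesSubset a b c 7 6 9 ∨ ∀ x y : ℤ, 3 ∣ a * x ^ 2 + b * x * y + c * y ^ 2

theorem HasReducedValues.of_valuesSubset {a b c a' b' c' : ℤ} (h : ValuesSubset a b c a' b' c')
    (h' : HasReducedValues a' b' c') : HasReducedValues a b c :=
  h'.imp h.trans (Or.imp h.trans (Or.imp h.trans (Or.imp h.trans fun H x y => by
    obtain ⟨u, v, e⟩ := h x y
    exact e ▸ H u v)))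

theorem hasReducedValues_of_reduced {a b c : ℤ} (ha : 0 < a) (hac : a ≤ c)
    (h : a * c - b ^ 2 = 54) (hb : -a ≤ 2 * b) (hb' : 2 * b ≤ a) :
    HasReducedValues a (2 * b) c := by
  have key : (a = 1 ∧ b = 0 ∧ c = 54) ∨ (a = 2 ∧ b = 0 ∧ c = 27) ∨
      (a = 5 ∧ (b = 1 ∨ b = -1) ∧ c = 11) ∨ (a = 7 ∧ (b = 3 ∨ b = -3) ∧ c = 9) ∨
        (3 ∣ a ∧ b = 0 ∧ 3 ∣ c) := by
    have ha8 : a ≤ 8 := by nlinarith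
    have hb4 : b ≤ 4 := by omega
    have hb4' : -4 ≤ b := by omega
    interval_cases a <;> interval_cases b <;> omega
  have self (A B C : ℤ) : ValuesSubset A B C A B C := fun x y => ⟨x, y, rfl⟩
  have conj (A B C : ℤ) : ValuesSubset A (2 * -B) C A (2 * B) C := fun x y => ⟨x, -y, by ring⟩
  rcases key with ⟨rfl, rfl, rfl⟩ | ⟨rfl, rfl, rfl⟩ | ⟨rfl, rfl | rfl, rfl⟩ |
    ⟨rfl, rfl | rfl, rfl⟩ | ⟨⟨a, rfl⟩, rfl, ⟨c, rfl⟩⟩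
  · exact Or.inl (self _ _ _)
  · exact Or.inr (Or.inl (self _ _ _))
  · exact Or.inr (Or.inr (Or.inl (self _ _ _)))
  · exact Or.inr (Or.inr (Or.inl (conj _ _ _)))
  · exact Or.inr (Or.inr (Or.inr (Or.inl (self _ _ _))))
  · exact Or.inr (Or.inr (Or.inr (Or.inl (conj _ _ _))))
  · exact Or.inr (Or.inr (Or.inr (Or.inr fun x y => ⟨a * x ^ 2 + c * y ^ 2, by ring⟩)))

/-- Reduction theory for discriminant `-216`, by descent on `a + c`. -/
theorem hasReducedValues_of_disc (a b c : ℤ) (ha : 0 < a) (hc : 0 < c)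
    (h : a * c - b ^ 2 = 54) : HasReducedValues a (2 * b) c := by
  induction hN : (a + c).toNat using Nat.strong_induction_on generalizing a b c with
  | _ N ih =>
  subst hN
  -- The substitution `x ↦ x - s y` with `s = ± 1` decreases `c` if `2|b| > a`.
  have step (s : ℤ) (hs : s ^ 2 = 1) (hlt : 2 * s * b + a < 0) :
      HasReducedValues a (2 * b) c := by
    have hc' : 0 < c + 2 * s * b + s ^ 2 * a := by
      by_contra hneg
      nlinarith [sq_nonneg (b + s * a), mul_nonneg ha.le (not_lt.1 hneg |> neg_nonneg.2)]
    refine .of_valuesSubset (fun x y => ⟨x - s * y, y, ?_⟩)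
      (ih _ ?_ a (b + s * a) (c + 2 * s * b + s ^ 2 * a) ha hc' (by linear_combination h) rfl)
    · ring
    · rw [hs] at hc' ⊢
      omega
  -- Likewise, `y ↦ y - s x` decreases `a` if `2|b| > c`.
  have step' (s : ℤ) (hs : s ^ 2 = 1) (hlt : 2 * s * b + c < 0) :
      HasReducedValues a (2 * b) c := by
    have ha' : 0 < a + 2 * s * b + s ^ 2 * c := by
      by_contra hneg
      nlinarith [sq_nonneg (b + s * c), mul_nonneg hc.le (not_lt.1 hneg |> neg_nonneg.2)]
    refine .of_valuesSubset (fun x y => ⟨x, y - s * x, ?_⟩)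
      (ih _ ?_ (a + 2 * s * b + s ^ 2 * c) (b + s * c) c ha' hc (by linear_combination h) rfl)
    · ring
    · rw [hs] at ha' ⊢
      omega
  by_cases h1 : 2 * 1 * b + a < 0
  · exact step 1 (by norm_num) h1
  by_cases h2 : 2 * (-1) * b + a < 0
  · exact step (-1) (by norm_num) h2
  by_cases h3 : 2 * 1 * b + c < 0
  · exact step' 1 (by norm_num) h3
  by_cases h4 : 2 * (-1) * b + c < 0
  · exact step' (-1) (by norm_num) h4
  rcases le_total a c with hac | hac
  · exact hasReducedValues_of_reduced ha hac h (by omega) (by omega)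
  · have swap : ValuesSubset a (2 * b) c c (2 * b) a := fun x y => ⟨y, x, by ring⟩
    exact .of_valuesSubset swap (hasReducedValues_of_reduced hc hac
      (by linear_combination h) (by omega) (by omega))

/-- A prime not dividing `6` that divides a square-free value of `5x² + 2xy + 11y²` is represented
by one of the primitive forms of discriminant `-216`. -/
theorem exists_form_of_prime_dvd {p m x y : ℤ} (hp : Prime p) (hpos : 0 < p) (h6 : ¬ p ∣ 6)
    (hsq : Squarefree m) (hm : m = 5 * x ^ 2 + 2 * x * y + 11 * y ^ 2) (hpm : p ∣ m) :
    (∃ u v, p = u ^ 2 + 54 * v ^ 2) ∨ (∃ u v, p = 2 * u ^ 2 + 27 * v ^ 2) ∨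
      (∃ u v, p = 5 * u ^ 2 + 2 * u * v + 11 * v ^ 2) ∨
        ∃ u v, p = 7 * u ^ 2 + 6 * u * v + 9 * v ^ 2 := by
  by_cases hy : p ∣ y
  · -- Then `p` divides `5x²`, and it does not divide `x`, so that `p = 5`.
    have h5 : p ∣ 5 * x ^ 2 := by
      obtain ⟨k, hk⟩ := hpm
      obtain ⟨t, rfl⟩ := hy
      exact ⟨k - 2 * x * t - 11 * p * t ^ 2, by linear_combination hk - hm⟩
    rcases hp.dvd_or_dvd h5 with h | h
    · refine Or.inr (Or.inr (Or.inl ⟨1, 0, ?_⟩))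
      have := Int.le_of_dvd (by norm_num) h
      interval_cases p <;> omega
    · obtain ⟨s, rfl⟩ := hp.dvd_of_dvd_pow h
      obtain ⟨t, rfl⟩ := hy
      exact absurd (hsq p ⟨5 * s ^ 2 + 2 * s * t + 11 * t ^ 2, by linear_combination hm⟩)
        hp.not_isUnit
  · -- Then `-54` is a square modulo `p`, so some form `(p, 2t, k)` has discriminant `-216`.
    obtain ⟨α, β, hαβ⟩ := (hp.coprime_iff_not_dvd.2 hy : IsCoprime p y)
    obtain ⟨j, hj⟩ := hpm
    obtain ⟨k, hk⟩ : p ∣ ((5 * x + y) * β) ^ 2 + 54 :=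
      ⟨5 * j * β ^ 2 + 54 * α * (1 + β * y), by
        linear_combination 5 * β ^ 2 * hj - 5 * β ^ 2 * hm - 54 * (1 + β * y) * hαβ⟩
    have hk0 : 0 < k := by
      by_contra hneg
      nlinarith [sq_nonneg ((5 * x + y) * β), mul_nonneg hpos.le (not_lt.1 hneg |> neg_nonneg.2)]
    have at_one {A B C : ℤ} (H : ValuesSubset p (2 * ((5 * x + y) * β)) k A B C) :
        ∃ u v, p = A * u ^ 2 + B * u * v + C * v ^ 2 := by
      obtain ⟨u, v, h⟩ := H 1 0
      exact ⟨u, v, by linear_combination h⟩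
    rcases hasReducedValues_of_disc p ((5 * x + y) * β) k hpos hk0 (by linear_combination -hk) with
      H | H | H | H | H
    · obtain ⟨u, v, h⟩ := at_one H
      exact Or.inl ⟨u, v, by linear_combination h⟩
    · obtain ⟨u, v, h⟩ := at_one H
      exact Or.inr (Or.inl ⟨u, v, by linear_combination h⟩)
    · exact Or.inr (Or.inr (Or.inl (at_one H)))
    · exact Or.inr (Or.inr (Or.inr (at_one H)))
    · have h3 : (3 : ℤ) ∣ p := by simpa using H 1 0
      have := (Int.prime_three.associated_of_dvd hp h3).symm.dvd
      exact absurd (this.trans (by norm_num)) h6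

/-! ### Parity of representation numbers -/

/-- If an involution preserves `A` and exchanges `P` with its negation, then half of the elements
of `A` satisfy `P`. -/
theorem ncard_eq_two_mul_of_involutive {α : Type*} {A : Set α} (hA : A.Finite) {σ : α → α}
    (hσ : Function.Involutive σ) (P : α → Prop) (hmem : ∀ v ∈ A, σ v ∈ A)
    (hP : ∀ v ∈ A, P (σ v) ↔ ¬ P v) : A.ncard = 2 * {v ∈ A | P v}.ncard := by
  have hunion : A = {v ∈ A | P v} ∪ σ '' {v ∈ A | P v} := by
    ext v
    constructor
    · intro hv
      by_cases h : P v
      · exact Or.inl ⟨hv, h⟩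
      · exact Or.inr ⟨σ v, ⟨hmem v hv, (hP v hv).2 h⟩, hσ v⟩
    · rintro (⟨hv, -⟩ | ⟨w, ⟨hw, -⟩, rfl⟩)
      · exact hv
      · exact hmem w hw
  have hdisj : Disjoint {v ∈ A | P v} (σ '' {v ∈ A | P v}) := by
    rw [Set.disjoint_left]
    rintro v ⟨-, h⟩ ⟨w, ⟨hw, h'⟩, rfl⟩
    exact (hP w hw).1 h h'
  have hfin : {v ∈ A | P v}.Finite := hA.subset fun v hv => hv.1
  conv_lhs => rw [hunion]
  rw [Set.ncard_union_eq hdisj hfin (hfin.image σ), Set.ncard_image_of_injective _ hσ.injective]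
  omega

/-- Central symmetry `v ↦ -v` makes the representation numbers of a nonzero integer even. -/
theorem two_dvd_R {n a b c : ℤ} (hn : n ≠ 0) (ha : 0 < a) (hD : b ^ 2 - 4 * a * c < 0) :
    2 ∣ R n a b c := by
  refine ⟨_, ncard_eq_two_mul_of_involutive (reprSet_finite n a b c ha hD) (σ := fun v => -v)
    neg_involutive (fun v => 0 < v.1 ∨ v.1 = 0 ∧ 0 < v.2) ?_ ?_⟩
  · rintro ⟨x, y⟩ (h : n = _)
    change n = _
    rw [h]
    simp
  · rintro ⟨x, y⟩ (h : n = _)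
    have : ¬ (x = 0 ∧ y = 0) := by
      rintro ⟨rfl, rfl⟩
      exact hn (by rw [h]; ring)
    simp only [Prod.fst_neg, Prod.snd_neg]
    omega

/-- For a diagonal form, sign changes of the two coordinates act freely on the representations
of `n`, provided that these have no vanishing coordinate. -/
theorem four_dvd_R {n a c : ℤ} (ha : 0 < a) (hc : 0 < c) (hx : ∀ x, n ≠ a * x ^ 2)
    (hy : ∀ y, n ≠ c * y ^ 2) : 4 ∣ R n a 0 c := by
  have hfin := reprSet_finite n a 0 c ha (by nlinarith [mul_pos ha hc])
  have hne : ∀ v ∈ reprSet n a 0 c, v.1 ≠ 0 ∧ v.2 ≠ 0 := by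
    rintro ⟨x, y⟩ (h : n = _)
    refine ⟨?_, ?_⟩
    · rintro rfl
      exact hy y (by rw [h]; ring)
    · rintro rfl
      exact hx x (by rw [h]; ring)
  have h₁ := ncard_eq_two_mul_of_involutive hfin (σ := fun v => (-v.1, v.2))
    (fun v => by simp) (fun v => 0 < v.1)
    (fun v (h : n = _) => by change n = _; rw [h]; simp)
    (fun v hv => by have := (hne v hv).1; simp only; omega)
  have h₂ := ncard_eq_two_mul_of_involutive
    (hfin.subset (fun v hv => hv.1 : {v ∈ reprSet n a 0 c | 0 < v.1} ⊆ _))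
    (σ := fun v => (v.1, -v.2)) (fun v => by simp) (fun v => 0 < v.2)
    (fun v hv => ⟨by have h : n = _ := hv.1; change n = _; rw [h]; simp, hv.2⟩)
    (fun v hv => by have := (hne v hv.1).2; simp only; omega)
  rw [R, h₁, h₂, ← mul_assoc]
  exact dvd_mul_right _ _

theorem R_one_principal : R 1 1 0 54 = 2 := by
  have : reprSet 1 1 0 54 = {(1, 0), (-1, 0)} := by
    ext ⟨x, y⟩
    simp only [reprSet, Set.mem_ofPred_eq, Set.mem_insert_iff, Set.mem_singleton_iff,
      Prod.mk.injEq]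
    constructor
    · intro h
      have hy : y = 0 := by
        by_contra hy
        nlinarith [sq_nonneg x, sq_pos_of_ne_zero hy]
      subst hy
      have : x ^ 2 = 1 := by linear_combination -h
      simpa using sq_eq_one_iff.1 this
    · rintro (⟨rfl, rfl⟩ | ⟨rfl, rfl⟩) <;> norm_num
  rw [R, this, Set.ncard_pair (by decide)]

theorem R_one_seven : R 1 7 6 9 = 0 := by
  have : reprSet 1 7 6 9 = ∅ := by
    ext ⟨x, y⟩
    simp only [reprSet, Set.mem_ofPred_eq, Set.mem_empty_iff_false, iff_false]
    intro h
    have hx : x = 0 := by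
      by_contra hx
      nlinarith [sq_nonneg (x + 3 * y), sq_pos_of_ne_zero hx]
    subst hx
    omega
  rw [R, this, Set.ncard_empty]

/-! ### Representation numbers modulo 4 -/

theorem not_dvd_six_of_not_dvd {p n : ℕ} (hp : p.Prime) (hpn : p ∣ n) (h2 : n % 2 = 1)
    (h3 : n % 3 ≠ 0) : ¬ (p : ℤ) ∣ 6 := fun h => by
  have h6 : p ∣ 2 * 3 := by exact_mod_cast h
  rcases hp.dvd_mul.1 h6 with h | h
  · have := (Nat.prime_dvd_prime_iff_eq hp Nat.prime_two).1 h
    subst this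
    omega
  · have := (Nat.prime_dvd_prime_iff_eq hp Nat.prime_three).1 h
    subst this
    omega

theorem four_dvd_R_principal {n : ℕ} (hsq : Squarefree n) (h1 : n ≠ 1) (h3 : n % 3 ≠ 0) :
    4 ∣ R n 1 0 54 := by
  refine four_dvd_R (by norm_num) (by norm_num) (fun x h => h1 ?_) (fun y h => by omega)
  have hu := Int.squarefree_natCast.2 hsq x ⟨1, by linear_combination h⟩
  have h' : (n : ℤ) = 1 := by rw [h, one_mul, sq, Int.isUnit_mul_self hu]
  exact_mod_cast h'

theorem four_dvd_R_two {n : ℕ} (h2 : n % 2 = 1) (h3 : n % 3 ≠ 0) : 4 ∣ R n 2 0 27 :=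
  four_dvd_R (by norm_num) (by norm_num) (fun x h => by omega) (fun y h => by omega)

/-- If all prime factors of the square-free number `n` have classes of order divisible by `3`, then
`R(n, 5x² + 2xy + 11y²)` or `R(n, 7x² + 6xy + 9y²)`, according to the genus of `n`, is congruent
to `2` modulo `4`. By induction: in each Hecke relation one summand belongs to an ambiguous form
and vanishes modulo `4`, and the other is covered by the induction hypothesis. -/
theorem R_modEq_two_of_prime_factors (n : ℕ) (hsq : Squarefree n)
    (hS : ∀ p, p.Prime → p ∣ n → p ∈ S₁ ∪ S₂ ∪ (S₃ ∪ S₄)) (h2 : n % 2 = 1) :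
    (n % 3 = 2 → R n 5 2 11 ≡ 2 [MOD 4]) ∧ (n % 3 = 1 → n ≠ 1 → R n 7 6 9 ≡ 2 [MOD 4]) := by
  induction n using induction_on_primes with
  | zero => omega
  | one => simp
  | prime_mul p a hp ih =>
    obtain ⟨hcop, -, hsqa⟩ := Nat.squarefree_mul_iff.1 hsq
    have hpZ := Nat.prime_iff_prime_int.1 hp
    have hpa : ¬ (p : ℤ) ∣ (a : ℤ) := fun h =>
      (hp.coprime_iff_not_dvd.1 hcop) (Int.natCast_dvd_natCast.1 h)
    have h2a : a % 2 = 1 := by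
      rw [Nat.mul_mod] at h2
      rcases Nat.mod_two_eq_zero_or_one a with h | h
      · simp [h] at h2
      · exact h
    obtain ⟨ih₅, ih₇⟩ := ih hsqa (fun q hq hqa => hS q hq (hqa.mul_left p)) h2a
    have hmod3 : p * a % 3 = p % 3 * (a % 3) % 3 := Nat.mul_mod _ _ _
    have h6 (h3 : p * a % 3 ≠ 0) : ¬ (p : ℤ) ∣ 6 :=
      not_dvd_six_of_not_dvd hp (dvd_mul_right p a) h2 h3
    push_cast
    -- The summand of an ambiguous form together with that of the form of order divisible by `3`.
    have principal_add (h3 : a % 3 = 1) : R a 1 0 54 + R a 7 6 9 ≡ 2 [MOD 4] := by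
      by_cases h1 : a = 1
      · subst h1
        rw [Nat.cast_one, R_one_principal, R_one_seven]
      · exact ((Nat.modEq_zero_iff_dvd.2 (four_dvd_R_principal hsqa h1 (by omega))).add
          (ih₇ h3 h1))
    have two_add (h3 : a % 3 = 2) : R a 2 0 27 + R a 5 2 11 ≡ 2 [MOD 4] :=
      (Nat.modEq_zero_iff_dvd.2 (four_dvd_R_two h2a (by omega))).add (ih₅ h3)
    have ha3 : a % 3 < 3 := Nat.mod_lt _ (by norm_num)
    rcases hS p hp (dvd_mul_right p a) with hp₅ | hp₇
    · have hp3 : p % 3 = 2 := by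
        rcases hp₅ with ⟨-, h, -⟩ | ⟨-, h, -⟩ <;> · unfold Nat.ModEq at h; omega
      obtain ⟨u, v, huv⟩ : ∃ u v : ℤ, (p : ℤ) = 5 * u ^ 2 + 2 * u * v + 11 * v ^ 2 := by
        rcases hp₅ with ⟨-, -, h⟩ | ⟨-, -, h⟩ <;> exact h
      rw [hp3] at hmod3
      refine ⟨fun h3 => ?_, fun h3 _ => ?_⟩
      · rw [R_mul_5_of_eq_5 hpZ (h6 (by omega)) hpa huv]
        exact principal_add (by omega)
      · rw [R_mul_7_of_eq_5 hpZ (h6 (by omega)) hpa huv]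
        exact two_add (by omega)
    · have hp3 : p % 3 = 1 := by
        rcases hp₇ with ⟨-, h, -⟩ | ⟨-, h, -⟩ <;> · unfold Nat.ModEq at h; omega
      obtain ⟨u, v, huv⟩ : ∃ u v : ℤ, (p : ℤ) = 7 * u ^ 2 + 6 * u * v + 9 * v ^ 2 := by
        rcases hp₇ with ⟨-, -, h⟩ | ⟨-, -, h⟩ <;> exact h
      rw [hp3] at hmod3
      refine ⟨fun h3 => ?_, fun h3 _ => ?_⟩
      · rw [R_mul_5_of_eq_7 hpZ (h6 (by omega)) hpa huv]
        exact two_add (by omega)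
      · rw [R_mul_7_of_eq_7 hpZ (h6 (by omega)) hpa huv]
        exact principal_add (by omega)

theorem not_two_dvd_and_not_three_dvd {p : ℕ} (hp : p.Prime) (h6 : ¬ (p : ℤ) ∣ 6) :
    ¬ 2 ∣ p ∧ ¬ 3 ∣ p := by
  refine ⟨fun h => h6 ?_, fun h => h6 ?_⟩
  · rw [← (Nat.prime_dvd_prime_iff_eq Nat.prime_two hp).1 h]
    norm_num
  · rw [← (Nat.prime_dvd_prime_iff_eq Nat.prime_three hp).1 h]
    norm_num

theorem mem_of_eq_five {p : ℕ} {x y : ℤ} (hp : p.Prime) (h6 : ¬ (p : ℤ) ∣ 6)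
    (h : (p : ℤ) = 5 * x ^ 2 + 2 * x * y + 11 * y ^ 2) : p ∈ S₁ ∪ S₂ := by
  -- A value of the form is `11` or `5` modulo `24` unless it shares a factor with `24`.
  have key : ∀ x y : ZMod 24, let n := 5 * x ^ 2 + 2 * x * y + 11 * y ^ 2
      n = 11 ∨ n = 5 ∨ 12 * n = 0 ∨ 8 * n = 0 := by decide
  have hcast : ((p : ℕ) : ZMod 24) = 5 * (x : ZMod 24) ^ 2 + 2 * x * y + 11 * y ^ 2 := by
    have := congrArg (Int.cast : ℤ → ZMod 24) h
    push_cast at this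
    exact this
  have := key x y
  simp only [← hcast] at this
  obtain ⟨h2, h3⟩ := not_two_dvd_and_not_three_dvd hp h6
  rcases this with h' | h' | h' | h'
  · exact Or.inl ⟨hp, (ZMod.natCast_eq_natCast_iff p 11 24).1 (mod_cast h'), x, y, h⟩
  · exact Or.inr ⟨hp, (ZMod.natCast_eq_natCast_iff p 5 24).1 (mod_cast h'), x, y, h⟩
  · have := (ZMod.natCast_eq_zero_iff (12 * p) 24).1 (mod_cast h')
    omega
  · have := (ZMod.natCast_eq_zero_iff (8 * p) 24).1 (mod_cast h')
    omega

theorem mem_of_eq_seven {p : ℕ} {x y : ℤ} (hp : p.Prime) (h6 : ¬ (p : ℤ) ∣ 6)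
    (h : (p : ℤ) = 7 * x ^ 2 + 6 * x * y + 9 * y ^ 2) : p ∈ S₃ ∪ S₄ := by
  have key : ∀ x y : ZMod 24, let n := 7 * x ^ 2 + 6 * x * y + 9 * y ^ 2
      n = 1 ∨ n = 7 ∨ 12 * n = 0 ∨ 8 * n = 0 := by decide
  have hcast : ((p : ℕ) : ZMod 24) = 7 * (x : ZMod 24) ^ 2 + 6 * x * y + 9 * y ^ 2 := by
    have := congrArg (Int.cast : ℤ → ZMod 24) h
    push_cast at this
    exact this
  have := key x y
  simp only [← hcast] at this
  obtain ⟨h2, h3⟩ := not_two_dvd_and_not_three_dvd hp h6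
  rcases this with h' | h' | h' | h'
  · exact Or.inl ⟨hp, (ZMod.natCast_eq_natCast_iff p 1 24).1 (mod_cast h'), x, y, h⟩
  · exact Or.inr ⟨hp, (ZMod.natCast_eq_natCast_iff p 7 24).1 (mod_cast h'), x, y, h⟩
  · have := (ZMod.natCast_eq_zero_iff (12 * p) 24).1 (mod_cast h')
    omega
  · have := (ZMod.natCast_eq_zero_iff (8 * p) 24).1 (mod_cast h')
    omega

/-- Conversely, a prime factor whose class is ambiguous makes `R(n, 5x² + 2xy + 11y²)` divisible
by `4`, and an inert one makes it vanish. -/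
theorem prime_factor_mem_of_R_modEq_two {n p : ℕ} (hsq : Squarefree n) (h2 : n % 2 = 1)
    (h3 : n % 3 ≠ 0) (hR : R n 5 2 11 ≡ 2 [MOD 4]) (hp : p.Prime) (hpn : p ∣ n) :
    p ∈ S₁ ∪ S₂ ∪ (S₃ ∪ S₄) := by
  have hpZ := Nat.prime_iff_prime_int.1 hp
  have h6 := not_dvd_six_of_not_dvd hp hpn h2 h3
  have hne : R n 5 2 11 ≠ 0 := fun h => by
    rw [h] at hR
    exact absurd hR (by decide)
  obtain ⟨⟨x, y⟩, hxy⟩ := Set.nonempty_of_ncard_ne_zero hne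
  have hform := exists_form_of_prime_dvd hpZ (mod_cast hp.pos) h6
    (Int.squarefree_natCast.2 hsq) hxy (Int.natCast_dvd_natCast.2 hpn)
  obtain ⟨a, rfl⟩ := hpn
  obtain ⟨hcop, -, hsqa⟩ := Nat.squarefree_mul_iff.1 hsq
  have hpa : ¬ (p : ℤ) ∣ (a : ℤ) := fun h =>
    (hp.coprime_iff_not_dvd.1 hcop) (Int.natCast_dvd_natCast.1 h)
  have ha : (a : ℤ) ≠ 0 := mod_cast hsqa.ne_zero
  push_cast at hR
  rcases hform with ⟨u, v, h⟩ | ⟨u, v, h⟩ | ⟨u, v, h⟩ | ⟨u, v, h⟩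
  · rw [R_mul_5_of_eq_1 hpZ h6 hpa h] at hR
    have := two_dvd_R ha (show (0 : ℤ) < 5 by norm_num) (b := 2) (c := 11) (by norm_num)
    unfold Nat.ModEq at hR
    omega
  · rw [R_mul_5_of_eq_2 hpZ h6 hpa h] at hR
    have := two_dvd_R ha (show (0 : ℤ) < 7 by norm_num) (b := 6) (c := 9) (by norm_num)
    unfold Nat.ModEq at hR
    omega
  · exact Or.inl (mem_of_eq_five hp h6 h)
  · exact Or.inr (mem_of_eq_seven hp h6 h)

/-! ### Products of primes from the four sets -/

theorem exists_isProductOfSizes (n : ℕ) (hn : n ≠ 0)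
    (hS : ∀ p, p.Prime → p ∣ n → p ∈ S₁ ∪ S₂ ∪ (S₃ ∪ S₄)) :
    ∃ n₁ n₂ n₃ n₄, IsProductOfSizes n n₁ n₂ n₃ n₄ := by
  induction n using induction_on_primes with
  | zero => exact absurd rfl hn
  | one =>
    exact ⟨0, 0, 0, 0, Fin.elim0, Fin.elim0, Fin.elim0, Fin.elim0, by simp, by simp, by simp,
      by simp, by simp⟩
  | prime_mul r a hr ih =>
    obtain ⟨n₁, n₂, n₃, n₄, p, p', q, q', h₁, h₂, h₃, h₄, h⟩ :=
      ih (right_ne_zero_of_mul hn) fun s hs hsa => hS s hs (hsa.mul_left r)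
    have ha : a = (∏ i, p i) * (∏ i, p' i) * (∏ i, q i) * (∏ i, q' i) := by exact_mod_cast h
    rcases hS r hr (dvd_mul_right r a) with (hr' | hr') | (hr' | hr')
    · refine ⟨n₁ + 1, n₂, n₃, n₄, Fin.cons r p, p', q, q', Fin.cases hr' h₁, h₂, h₃, h₄, ?_⟩
      rw [Fin.prod_cons, ha]
      congr 1
      ring
    · refine ⟨n₁, n₂ + 1, n₃, n₄, p, Fin.cons r p', q, q', h₁, Fin.cases hr' h₂, h₃, h₄, ?_⟩
      rw [Fin.prod_cons, ha]
      congr 1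
      ring
    · refine ⟨n₁, n₂, n₃ + 1, n₄, p, p', Fin.cons r q, q', h₁, h₂, Fin.cases hr' h₃, h₄, ?_⟩
      rw [Fin.prod_cons, ha]
      congr 1
      ring
    · refine ⟨n₁, n₂, n₃, n₄ + 1, p, p', q, Fin.cons r q', h₁, h₂, h₃, Fin.cases hr' h₄, ?_⟩
      rw [Fin.prod_cons, ha]
      congr 1
      ring

theorem IsProductOfSizes.prime_factor_mem {n n₁ n₂ n₃ n₄ : ℕ} (h : IsProductOfSizes n n₁ n₂ n₃ n₄)
    {r : ℕ} (hr : r.Prime) (hrn : r ∣ n) : r ∈ S₁ ∪ S₂ ∪ (S₃ ∪ S₄) := by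
  obtain ⟨p, p', q, q', h₁, h₂, h₃, h₄, h⟩ := h
  have hn : n = (∏ i, p i) * (∏ i, p' i) * (∏ i, q i) * (∏ i, q' i) := by exact_mod_cast h
  rw [hn, hr.dvd_mul, hr.dvd_mul, hr.dvd_mul] at hrn
  have mem {k : ℕ} {f : Fin k → ℕ} {A : Set ℕ} (hA : ∀ s ∈ A, s.Prime) (hf : ∀ i, f i ∈ A)
      (hd : r ∣ ∏ i, f i) : r ∈ A := by
    obtain ⟨i, -, hi⟩ := (hr.prime.dvd_finsetProd_iff f).1 hd
    exact (Nat.prime_dvd_prime_iff_eq hr (hA _ (hf i))).1 hi ▸ hf i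
  rcases hrn with ((hd | hd) | hd) | hd
  · exact Or.inl (Or.inl (mem (fun _ hs => hs.1) h₁ hd))
  · exact Or.inl (Or.inr (mem (fun _ hs => hs.1) h₂ hd))
  · exact Or.inr (Or.inl (mem (fun _ hs => hs.1) h₃ hd))
  · exact Or.inr (Or.inr (mem (fun _ hs => hs.1) h₄ hd))

/-- The residue class `11` modulo `24` of a product forces the parities in forms (i) and (ii): the
classes `5` and `7` are independent of order two in `(ℤ/24ℤ)ˣ`, and `11 = 5 · 7`. -/
theorem IsProductOfSizes.parity {m : ℤ} {n₁ n₂ n₃ n₄ : ℕ} (h : IsProductOfSizes m n₁ n₂ n₃ n₄)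
    (hm : m ≡ 11 [ZMOD 24]) :
    (Odd n₁ ∧ Even n₂ ∧ Even n₄) ∨ (Even n₁ ∧ Odd n₂ ∧ Odd n₄) := by
  obtain ⟨p, p', q, q', h₁, h₂, h₃, h₄, rfl⟩ := h
  have prod_eq {k r : ℕ} {f : Fin k → ℕ} (hf : ∀ i, f i ≡ r [MOD 24]) :
      ((∏ i, f i : ℕ) : ZMod 24) = (r : ZMod 24) ^ k := by
    rw [Nat.cast_prod,
      Finset.prod_congr rfl fun i _ => (ZMod.natCast_eq_natCast_iff _ _ 24).2 (hf i)]
    simp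
  have key : (11 : ZMod 24) ^ n₁ * 5 ^ n₂ * 7 ^ n₄ = 11 := by
    have := (ZMod.intCast_eq_intCast_iff _ _ 24).2 hm
    rw [Int.cast_natCast, Nat.cast_mul, Nat.cast_mul, Nat.cast_mul,
      prod_eq fun i => (h₁ i).2.1, prod_eq fun i => (h₂ i).2.1, prod_eq fun i => (h₃ i).2.1,
      prod_eq fun i => (h₄ i).2.1] at this
    simpa using this
  have pow_even {x : ZMod 24} (hx : x ^ 2 = 1) {k : ℕ} (hk : Even k) : x ^ k = 1 := by
    obtain ⟨j, rfl⟩ := hk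
    rw [← two_mul, pow_mul, hx, one_pow]
  have pow_odd {x : ZMod 24} (hx : x ^ 2 = 1) {k : ℕ} (hk : Odd k) : x ^ k = x := by
    obtain ⟨j, rfl⟩ := hk
    rw [pow_succ, pow_mul, hx, one_pow, one_mul]
  have e₁ : (11 : ZMod 24) ^ 2 = 1 := by decide
  have e₂ : (5 : ZMod 24) ^ 2 = 1 := by decide
  have e₄ : (7 : ZMod 24) ^ 2 = 1 := by decide
  rcases Nat.even_or_odd n₁ with k₁ | k₁ <;> rcases Nat.even_or_odd n₂ with k₂ | k₂ <;>
    rcases Nat.even_or_odd n₄ with k₄ | k₄ <;>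
    first
    | exact Or.inl ⟨k₁, k₂, k₄⟩
    | exact Or.inr ⟨k₁, k₂, k₄⟩
    | (exfalso
       simp only [pow_even e₁, pow_even e₂, pow_even e₄, pow_odd e₁, pow_odd e₂, pow_odd e₄, k₁, k₂,
         k₄] at key
       revert key
       decide)

theorem theorem1 (m : ℤ) (hm : m ≡ 11 [ZMOD 24]) (hsq : Squarefree m) :
    R m 5 2 11 ≡ 2 [MOD 4] ↔ IsFormI m ∨ IsFormII m := by
  constructor
  · intro hR
    -- A negative `m` has no representations.
    obtain ⟨n, rfl⟩ : ∃ n : ℕ, m = n := by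
      refine Int.eq_ofNat_of_zero_le (not_lt.1 fun hneg => ?_)
      have hempty : reprSet m 5 2 11 = ∅ := by
        ext ⟨x, y⟩
        simp only [reprSet, Set.mem_ofPred_eq, Set.mem_empty_iff_false, iff_false]
        intro h
        nlinarith [sq_nonneg (x + y), sq_nonneg x, sq_nonneg y]
      rw [R, hempty, Set.ncard_empty] at hR
      exact absurd hR (by decide)
    have hsq' := Int.squarefree_natCast.1 hsq
    have hm' := hm
    unfold Int.ModEq at hm'
    obtain ⟨n₁, n₂, n₃, n₄, h⟩ := exists_isProductOfSizes n hsq'.ne_zero fun p hp hpn =>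
      prime_factor_mem_of_R_modEq_two hsq' (by omega) (by omega) hR hp hpn
    exact (h.parity hm).imp (fun ⟨k₁, k₂, k₄⟩ => ⟨n₁, n₂, n₃, n₄, k₁, k₂, k₄, h⟩)
      fun ⟨k₁, k₂, k₄⟩ => ⟨n₁, n₂, n₃, n₄, k₁, k₂, k₄, h⟩
  · intro h
    obtain ⟨n₁, n₂, n₃, n₄, h⟩ : ∃ n₁ n₂ n₃ n₄, IsProductOfSizes m n₁ n₂ n₃ n₄ := by
      rcases h with ⟨n₁, n₂, n₃, n₄, -, -, -, h⟩ | ⟨n₁, n₂, n₃, n₄, -, -, -, h⟩ <;>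
        exact ⟨n₁, n₂, n₃, n₄, h⟩
    obtain ⟨n, rfl⟩ : ∃ n : ℕ, m = n := by
      obtain ⟨_, _, _, _, -, -, -, -, h⟩ := h
      exact ⟨_, h⟩
    unfold Int.ModEq at hm
    exact (R_modEq_two_of_prime_factors n (Int.squarefree_natCast.1 hsq)
      (fun r hr hrn => h.prime_factor_mem hr hrn) (by omega)).1 (by omega)
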